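/- Let $K$ be a field, $\Gamma$ a group and $N\lhd\Gamma$ a normal subgroup. If $N$ is $K$-sofic and $\Gamma/N$ is amenable (as a discrete group), then $\Gamma$ is $K$-sofic. Here, for $n\ge 1$ and $A\in\mathrm{GL}_n(K)$, the rank length is $\ell_{\mathrm r}(A)=\operatorname{rank}(1-A)/n$. A group $\Gamma$ is called $K$-sofic if there are numbers $\delta_g>0$, $g\in\Gamma\setminus\{1\}$, such that for every $\varepsilon>0$ and every finite subset $E\subset\Gamma$ there are $n\ge 1$ and a map $\varphi\colon\Gamma\to\mathrm{GL}_n(K)$ with $\ell_{\mathrm r}(\varphi(1))\le\varepsilon$, with $\ell_{\mathrm r}(\varphi(g))\ge\delta_g$ for all $g\in E\setminus\{1\}$, and with $\ell_{\mathrm r}(\varphi(g)\varphi(h)\varphi(gh)^{-1})\le\varepsilon$ for all $g,h\in E$. A group $G$ is amenable if for every finite $S\subset G$ and every $\varepsilon>0$ there is a nonempty finite $F\subset G$ with $|sF\,\triangle\,F|\le\varepsilon|F|$ for all $s\in S$. -/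

import Mathlib

universe u v w

/-- The approximation property of a group `Γ` with respect to a class of groups `G i`, each with a
length function `ℓ i`. The lower bounds `δ g` are chosen before the finite set `E` and `ε`. -/
def HasApproximationProperty {ι : Type w} (G : ι → Type v) [∀ i, Group (G i)]
    (ℓ : ∀ i, G i → ℝ) (Γ : Type u) [Group Γ] : Prop :=
  ∃ δ : Γ → ℝ, (∀ g : Γ, g ≠ 1 → 0 < δ g) ∧
    ∀ ε : ℝ, 0 < ε → ∀ E : Finset Γ, ∃ (i : ι) (φ : Γ → G i),
      ℓ i (φ 1) ≤ ε ∧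
      (∀ g ∈ E, g ≠ 1 → δ g ≤ ℓ i (φ g)) ∧
      (∀ g ∈ E, ∀ h ∈ E, ℓ i (φ g * φ h * (φ (g * h))⁻¹) ≤ ε)

/-- The rank length `rank (1 - g) / n` on `GL_n(K)`. -/
noncomputable def rankLength {K : Type v} [Field K] (n : ℕ) (g : Matrix.GeneralLinearGroup (Fin n) K) :
    ℝ :=
  ((1 - (g : Matrix (Fin n) (Fin n) K)).rank : ℝ) / (n : ℝ)

/-- A group is `K`-sofic if it has the approximation property with respect to the groups `GL_n(K)`,
`n ≥ 1`, with the rank length. -/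
def IsKSofic (K : Type v) [Field K] (Γ : Type u) [Group Γ] : Prop :=
  HasApproximationProperty (fun n : {n : ℕ // 0 < n} => Matrix.GeneralLinearGroup (Fin n.1) K)
    (fun n => rankLength n.1) Γ

open scoped Classical in
/-- Amenability of a discrete group, by the Følner condition: for every finite `S` and `ε > 0`
there is a nonempty finite set `F` with `|sF ∆ F| ≤ ε |F|` for all `s ∈ S`. -/
def IsAmenableGroup (G : Type u) [Group G] : Prop :=
  ∀ (S : Finset G) (ε : ℝ), 0 < ε → ∃ F : Finset G, F.Nonempty ∧
    ∀ s ∈ S, ((symmDiff (F.image (fun x => s * x)) F).card : ℝ) ≤ ε * (F.card : ℝ)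

/-! The natural construction is induction. Given a Følner set `F` of `Γ ⧸ N` and an approximation
`ψ` of `N` on `V`, let `g` act on `V ^ F` by moving the `q`-th copy of `V` to the `gq`-th through
`ψ` of the cocycle value `sectionCocycle N g q`. Points `q` with `gq` outside `F` are few, so the
permutation may be completed arbitrarily there, and the cocycle identity gives multiplicativity up
to a small rank (`IsRankApprox.exists_induced`). If `g` is outside `N`, the permutation displaces
most copies, so the rank of `g - 1` is large. If `g` lies in `N`, the action is block diagonal and
its blocks are `ψ` of conjugates of `g`.

These conjugates vary with `F`, hence with `ε`, and the bounds `δ` on `N` may have no positive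
infimum over them. So `δ` is first made uniform (`hasRankApprox_uniform`): the functor `A ↦ (A ⊗ A)
⊕ (A ⊗ 1)` multiplies small relative ranks of `A - 1` by at least `5/4`, and errors by at most
`3/2`. Since `δ` precedes `ε`, the number of iterations depends only on `δ` and `E`, and a finer
initial precision absorbs the error growth. -/

open Module TensorProduct

/-! ### Rank inequalities for linear maps and tensor products. -/

section RankOfLinearMaps

variable {K : Type*} [Field K]
variable {U V W X : Type*} [AddCommGroup U] [Module K U] [AddCommGroup V] [Module K V]
  [AddCommGroup W] [Module K W] [AddCommGroup X] [Module K X]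

/-- The rank of a linear map, as a natural number. -/
noncomputable def linRank (f : V →ₗ[K] W) : ℕ := finrank K (LinearMap.range f)

theorem linRank_le_domain [FiniteDimensional K V] (f : V →ₗ[K] W) : linRank f ≤ finrank K V :=
  LinearMap.finrank_range_le f

theorem linRank_comp_le_left [FiniteDimensional K W] (g : V →ₗ[K] W) (f : U →ₗ[K] V) :
    linRank (g ∘ₗ f) ≤ linRank g :=
  Submodule.finrank_mono (LinearMap.range_comp_le_range f g)

theorem linRank_comp_le_right [FiniteDimensional K V] (g : V →ₗ[K] W) (f : U →ₗ[K] V) :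
    linRank (g ∘ₗ f) ≤ linRank f := by
  unfold linRank
  rw [LinearMap.range_comp]
  exact Submodule.finrank_map_le _ _

theorem linRank_eq_domain_of_injective (f : V →ₗ[K] W) (hf : Function.Injective f) :
    linRank f = finrank K V :=
  LinearMap.finrank_range_of_inj hf

@[simp]
theorem linRank_neg (f : V →ₗ[K] W) : linRank (-f) = linRank f := by
  unfold linRank
  rw [LinearMap.range_neg]

@[simp]
theorem linRank_zero : linRank (0 : V →ₗ[K] W) = 0 := by
  rw [linRank, LinearMap.range_zero, finrank_bot]

theorem linRank_sub_comm (f g : V →ₗ[K] W) : linRank (f - g) = linRank (g - f) := by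
  rw [← linRank_neg, neg_sub]

theorem linRank_add_le [FiniteDimensional K W] (f g : V →ₗ[K] W) :
    linRank (f + g) ≤ linRank f + linRank g := by
  refine (Submodule.finrank_mono (t := LinearMap.range f ⊔ LinearMap.range g) ?_).trans
    (Submodule.finrank_add_le_finrank_add_finrank _ _)
  rintro _ ⟨x, rfl⟩
  exact Submodule.add_mem_sup ⟨x, rfl⟩ ⟨x, rfl⟩

theorem linRank_sum_le [FiniteDimensional K W] {ι : Type*} (s : Finset ι) (f : ι → V →ₗ[K] W) :
    linRank (∑ i ∈ s, f i) ≤ ∑ i ∈ s, linRank (f i) := by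
  classical
  induction s using Finset.induction_on with
  | empty => simp
  | insert a s ha ih =>
    rw [Finset.sum_insert ha, Finset.sum_insert ha]
    exact (linRank_add_le _ _).trans (by gcongr)

theorem linRank_comp_linearEquiv (g : V →ₗ[K] W) (e : U ≃ₗ[K] V) :
    linRank (g ∘ₗ (e : U →ₗ[K] V)) = linRank g := by
  unfold linRank
  rw [LinearMap.range_comp_of_range_eq_top _ (LinearEquiv.range e)]

theorem linRank_linearEquiv_comp (e : V ≃ₗ[K] W) (f : U →ₗ[K] V) :
    linRank ((e : V →ₗ[K] W) ∘ₗ f) = linRank f := by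
  unfold linRank
  rw [LinearMap.range_comp]
  exact LinearEquiv.finrank_map_eq e _

theorem finrank_map_add_finrank_inf_ker [FiniteDimensional K V] (f : V →ₗ[K] W)
    (S : Submodule K V) :
    finrank K (S.map f) + finrank K ↥(S ⊓ LinearMap.ker f) = finrank K S := by
  rw [← LinearMap.finrank_range_add_finrank_ker (f.domRestrict S), LinearMap.range_domRestrict]
  congr 1
  rw [LinearMap.ker_domRestrict, ← Submodule.map_comap_subtype]
  exact Submodule.finrank_map_subtype_eq S ((LinearMap.ker f).comap S.subtype)

/-- Rank-nullity for `X'` restricted to the range of `M`: the image contains the range of `X' M y`,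
the kernel that of `M z`. -/
theorem linRank_comp_add_le [FiniteDimensional K V] [FiniteDimensional K W] (X' : W →ₗ[K] X)
    (M : V →ₗ[K] W) {Y Z : Type*} [AddCommGroup Y] [Module K Y] [AddCommGroup Z] [Module K Z]
    (y : Y →ₗ[K] V) (z : Z →ₗ[K] V) (h : X' ∘ₗ M ∘ₗ z = 0) :
    linRank (X' ∘ₗ M ∘ₗ y) + linRank (M ∘ₗ z) ≤ linRank M := by
  rw [linRank, linRank, linRank, ← finrank_map_add_finrank_inf_ker X' (LinearMap.range M)]
  refine Nat.add_le_add (Submodule.finrank_mono ?_) (Submodule.finrank_mono ?_)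
  · rw [LinearMap.range_comp]
    exact Submodule.map_mono (LinearMap.range_comp_le_range _ _)
  · refine le_inf (LinearMap.range_comp_le_range _ _) ?_
    rintro _ ⟨t, rfl⟩
    exact LinearMap.congr_fun h t

theorem linRank_le_linRank_comp_add [FiniteDimensional K V] (g : V →ₗ[K] W) (f : U →ₗ[K] V) :
    linRank f ≤ linRank (g ∘ₗ f) + finrank K (LinearMap.ker g) := by
  rw [linRank, linRank, LinearMap.range_comp,
    ← finrank_map_add_finrank_inf_ker g (LinearMap.range f)]
  exact Nat.add_le_add_left (Submodule.finrank_mono inf_le_right) _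

theorem TensorProduct.map_sub_left (f g : U →ₗ[K] V) (h : W →ₗ[K] X) :
    TensorProduct.map (f - g) h = TensorProduct.map f h - TensorProduct.map g h :=
  eq_sub_of_add_eq (by rw [← TensorProduct.map_add_left, sub_add_cancel])

theorem TensorProduct.map_sub_right (h : U →ₗ[K] V) (f g : W →ₗ[K] X) :
    TensorProduct.map h (f - g) = TensorProduct.map h f - TensorProduct.map h g :=
  eq_sub_of_add_eq (by rw [← TensorProduct.map_add_right, sub_add_cancel])

theorem linRank_tensor_map (f : U →ₗ[K] V) (g : W →ₗ[K] X) :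
    linRank (TensorProduct.map f g) = linRank f * linRank g := by
  have h : TensorProduct.map f g =
      TensorProduct.map (LinearMap.range f).subtype (LinearMap.range g).subtype ∘ₗ
        TensorProduct.map f.rangeRestrict g.rangeRestrict := by
    rw [← TensorProduct.map_comp]
    rfl
  have hs : LinearMap.range (TensorProduct.map f.rangeRestrict g.rangeRestrict) = ⊤ :=
    LinearMap.range_eq_top.2 (TensorProduct.map_surjective f.surjective_rangeRestrict
      g.surjective_rangeRestrict)
  unfold linRank
  rw [h, LinearMap.range_comp_of_range_eq_top _ hs, LinearMap.finrank_range_of_inj,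
    Module.finrank_tensorProduct]
  exact TensorProduct.map_injective_of_flat_flat _ _ (Submodule.injective_subtype _)
    (Submodule.injective_subtype _)

theorem linRank_prodMap [FiniteDimensional K V] [FiniteDimensional K X]
    (f : U →ₗ[K] V) (g : W →ₗ[K] X) :
    linRank (f.prodMap g) = linRank f + linRank g := by
  have h : f.prodMap g = (LinearMap.range f).subtype.prodMap (LinearMap.range g).subtype ∘ₗ
        f.rangeRestrict.prodMap g.rangeRestrict := by
    ext <;> simp
  have hs : LinearMap.range (f.rangeRestrict.prodMap g.rangeRestrict) = ⊤ :=
    LinearMap.range_eq_top.2 (Function.Surjective.prodMap f.surjective_rangeRestrict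
      g.surjective_rangeRestrict)
  unfold linRank
  rw [h, LinearMap.range_comp_of_range_eq_top _ hs, LinearMap.finrank_range_of_inj,
    Module.finrank_prod]
  exact Function.Injective.prodMap (Submodule.injective_subtype _) (Submodule.injective_subtype _)

/-- If `A - 1` has small rank `r` on a space of dimension `n`, then `A ⊗ A - 1` has rank at least
`r (n - 2 r) + r (n - r)`. -/
theorem linRank_tensor_self_sub_id [FiniteDimensional K V] (A : V →ₗ[K] V) :
    2 * (linRank (A - LinearMap.id) * finrank K V : ℤ) - 3 * (linRank (A - LinearMap.id) : ℤ) ^ 2 ≤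
      linRank (TensorProduct.map A A - LinearMap.id) := by
  set R := A - LinearMap.id with hR
  have hA : A = LinearMap.id + R := by rw [hR]; abel
  set i := (LinearMap.ker R).subtype with hi
  have hRi : R ∘ₗ i = 0 := by ext x; simp [hi]
  have hAi : A ∘ₗ i = i := by rw [hA, LinearMap.add_comp, hRi, LinearMap.id_comp, add_zero]
  set q := (LinearMap.range R).mkQ with hq
  have hqR : q ∘ₗ R = 0 := by ext x; simp [hq]
  -- `A` is the identity on `ker R`, so `A ⊗ A - 1` is `1 ⊗ R` on `ker R ⊗ V` and `R ⊗ 1` on `V ⊗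
  -- ker R`. Dividing the first factor by the range of `R` kills the latter, so the two
  -- contributions add.
  have h1 : (TensorProduct.map A A - LinearMap.id) ∘ₗ TensorProduct.map i LinearMap.id =
      TensorProduct.map i R := by
    have h : TensorProduct.map i A = TensorProduct.map i LinearMap.id + TensorProduct.map i R := by
      rw [← TensorProduct.map_add_right, ← hA]
    rw [LinearMap.sub_comp, ← TensorProduct.map_comp, hAi, LinearMap.comp_id, LinearMap.id_comp, h,
      add_sub_cancel_left]
  have h2 : (TensorProduct.map A A - LinearMap.id) ∘ₗ TensorProduct.map LinearMap.id i =
      TensorProduct.map R i := by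
    have h : TensorProduct.map A i = TensorProduct.map LinearMap.id i + TensorProduct.map R i := by
      rw [← TensorProduct.map_add_left, ← hA]
    rw [LinearMap.sub_comp, ← TensorProduct.map_comp, hAi, LinearMap.comp_id, LinearMap.id_comp, h,
      add_sub_cancel_left]
  have h3 := linRank_comp_add_le (TensorProduct.map q (LinearMap.id : V →ₗ[K] V))
    (TensorProduct.map A A - LinearMap.id) (TensorProduct.map i LinearMap.id)
    (TensorProduct.map LinearMap.id i) (by
      rw [h2, ← TensorProduct.map_comp, hqR, TensorProduct.map_zero_left])
  rw [h1, h2, ← TensorProduct.map_comp, linRank_tensor_map, linRank_tensor_map,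
    LinearMap.id_comp] at h3
  -- `q ∘ₗ i` has rank at least `n - 2r`, which may be negative; hence the passage to `ℤ`.
  have h4 := linRank_le_linRank_comp_add q i
  have h5 : linRank i = finrank K (LinearMap.ker R) :=
    linRank_eq_domain_of_injective _ (Submodule.injective_subtype _)
  have h6 : linRank R + finrank K (LinearMap.ker R) = finrank K V :=
    LinearMap.finrank_range_add_finrank_ker R
  have h7 : finrank K (LinearMap.ker q) = linRank R := by rw [hq, Submodule.ker_mkQ]; rfl
  rw [h5] at h3 h4
  rw [h7] at h4
  zify at h3 h4 h6
  rw [← h6]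
  nlinarith [(Int.natCast_nonneg (linRank R) : (0:ℤ) ≤ linRank R)]

end RankOfLinearMaps

/-! ### Coordinate-free rank approximations. -/

section Approximation

variable {K : Type v} [Field K] {Γ : Type u} [Group Γ]

/-- The map `φ` is multiplicative on `E` up to rank defect `ε` and separates `g ∈ E` from `1` by
rank at least `δ g`, both relative to the dimension of `V`. -/
structure IsRankApprox {V : Type*} [AddCommGroup V] [Module K V] (φ : Γ → V ≃ₗ[K] V)
    (E : Finset Γ) (ε : ℝ) (δ : Γ → ℝ) : Prop where
  map_one : (linRank ((φ 1 : V →ₗ[K] V) - LinearMap.id) : ℝ) ≤ ε * finrank K V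
  le_rank : ∀ g ∈ E, g ≠ 1 →
    δ g * finrank K V ≤ (linRank ((φ g : V →ₗ[K] V) - LinearMap.id) : ℝ)
  map_mul : ∀ g ∈ E, ∀ h ∈ E,
    (linRank ((φ g : V →ₗ[K] V) ∘ₗ (φ h : V →ₗ[K] V) - (φ (g * h) : V →ₗ[K] V)) : ℝ) ≤
      ε * finrank K V

/-- A rank approximation exists on some nonzero finite-dimensional space. -/
def HasRankApprox (K : Type v) [Field K] {Γ : Type u} [Group Γ] (E : Finset Γ) (ε : ℝ)
    (δ : Γ → ℝ) : Prop :=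
  ∃ (V : Type v) (_ : AddCommGroup V) (_ : Module K V) (_ : FiniteDimensional K V)
    (_ : Nontrivial V) (φ : Γ → V ≃ₗ[K] V), IsRankApprox φ E ε δ

theorem HasRankApprox.mono {E : Finset Γ} {ε ε' : ℝ} {δ δ' : Γ → ℝ} (h : HasRankApprox K E ε δ)
    (hε : ε ≤ ε') (hδ : ∀ g ∈ E, g ≠ 1 → δ' g ≤ δ g) : HasRankApprox K E ε' δ' := by
  obtain ⟨V, i1, i2, i3, i4, φ, h1, h2, h3⟩ := h
  refine ⟨V, i1, i2, i3, i4, φ, h1.trans (by gcongr), fun g hg hg1 => ?_,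
    fun g hg h hh => (h3 g hg h hh).trans (by gcongr)⟩
  exact (mul_le_mul_of_nonneg_right (hδ g hg hg1) (Nat.cast_nonneg _)).trans (h2 g hg hg1)

/-! ### Amplification by tensor squares. -/

section Amplification

variable {V : Type*} [AddCommGroup V] [Module K V]

/-- The functor `A ↦ (A ⊗ A) ⊕ (A ⊗ 1)` on linear maps. -/
noncomputable def tensorDouble (A : V →ₗ[K] V) : (V ⊗[K] V) × (V ⊗[K] V) →ₗ[K]
    (V ⊗[K] V) × (V ⊗[K] V) :=
  (TensorProduct.map A A).prodMap (TensorProduct.map A LinearMap.id)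

/-- The functor `A ↦ (A ⊗ A) ⊕ (A ⊗ 1)` on automorphisms. -/
noncomputable def tensorDoubleEquiv (A : V ≃ₗ[K] V) :
    ((V ⊗[K] V) × (V ⊗[K] V)) ≃ₗ[K] (V ⊗[K] V) × (V ⊗[K] V) :=
  (TensorProduct.congr A A).prodCongr (TensorProduct.congr A (LinearEquiv.refl K V))

theorem tensorDouble_comp (A B : V →ₗ[K] V) :
    tensorDouble (A ∘ₗ B) = tensorDouble A ∘ₗ tensorDouble B := by
  rw [tensorDouble, tensorDouble, tensorDouble, LinearMap.prodMap_comp, ← TensorProduct.map_comp,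
    ← TensorProduct.map_comp, LinearMap.id_comp]

theorem tensorDouble_id : tensorDouble (LinearMap.id : V →ₗ[K] V) = LinearMap.id := by
  rw [tensorDouble, TensorProduct.map_id, LinearMap.prodMap_id]

variable [FiniteDimensional K V]

variable (K V) in
theorem finrank_tensorDouble :
    finrank K ((V ⊗[K] V) × (V ⊗[K] V)) = 2 * finrank K V ^ 2 := by
  rw [Module.finrank_prod, Module.finrank_tensorProduct]; ring

theorem linRank_tensorDouble_sub (A B : V →ₗ[K] V) :
    linRank (tensorDouble A - tensorDouble B) =
      linRank (TensorProduct.map A A - TensorProduct.map B B) + linRank (A - B) * finrank K V := by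
  have h : tensorDouble A - tensorDouble B =
      (TensorProduct.map A A - TensorProduct.map B B).prodMap
        (TensorProduct.map (A - B) LinearMap.id) := by
    rw [TensorProduct.map_sub_left]
    rfl
  rw [h, linRank_prodMap, linRank_tensor_map,
    linRank_eq_domain_of_injective (LinearMap.id : V →ₗ[K] V) Function.injective_id]

/-- Telescoping `A ⊗ A - B ⊗ B` costs two terms and `(A - B) ⊗ 1` a third; relative to dimension
`2n²` the error grows by `3/2`. -/
theorem linRank_tensorDouble_sub_le (A B : V →ₗ[K] V) :
    linRank (tensorDouble A - tensorDouble B) ≤ 3 * (linRank (A - B) * finrank K V) := by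
  have h : TensorProduct.map A A - TensorProduct.map B B =
      TensorProduct.map (A - B) A + TensorProduct.map B (A - B) := by
    rw [TensorProduct.map_sub_left, TensorProduct.map_sub_right]; abel
  have h1 := linRank_add_le (TensorProduct.map (A - B) A) (TensorProduct.map B (A - B))
  rw [linRank_tensor_map, linRank_tensor_map, ← h] at h1
  have h2 := Nat.mul_le_mul_left (linRank (A - B)) (linRank_le_domain A)
  have h3 := Nat.mul_le_mul_right (linRank (A - B)) (linRank_le_domain B)
  rw [linRank_tensorDouble_sub]
  linarith

/-- The tensor square alone can lose everything (`A = -1` gives `A ⊗ A = 1`); the summand `A ⊗ 1`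
retains half of the relative rank. -/
theorem le_linRank_tensorDouble_sub_id (A : V →ₗ[K] V) {δ : ℝ}
    (h : δ * finrank K V ≤ (linRank (A - LinearMap.id) : ℝ)) :
    min (5 / 4 * δ) (1 / 12) * finrank K ((V ⊗[K] V) × (V ⊗[K] V)) ≤
      (linRank (tensorDouble A - LinearMap.id) : ℝ) := by
  have h1 := linRank_tensorDouble_sub A LinearMap.id
  rw [tensorDouble_id, TensorProduct.map_id] at h1
  rw [h1, finrank_tensorDouble]
  have h2 : (2 * (linRank (A - LinearMap.id) * finrank K V) -
      3 * (linRank (A - LinearMap.id)) ^ 2 : ℝ) ≤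
      linRank (TensorProduct.map A A - LinearMap.id) := by
    exact_mod_cast linRank_tensor_self_sub_id A
  have h0 : (0 : ℝ) ≤ linRank (TensorProduct.map A A - LinearMap.id) := Nat.cast_nonneg _
  have hr : (0 : ℝ) ≤ linRank (A - LinearMap.id) := Nat.cast_nonneg _
  have hn : (0 : ℝ) ≤ finrank K V := Nat.cast_nonneg _
  push_cast
  generalize (linRank (TensorProduct.map A A - LinearMap.id) : ℝ) = t at *
  generalize (linRank (A - LinearMap.id) : ℝ) = r at *
  generalize (finrank K V : ℝ) = n at *
  -- For `r ≤ n/6` the total `3rn - 3r²` is at least `(5/2)rn`; for `r ≥ n/6` the summand `A ⊗ 1`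
  -- alone gives `n²/6`.
  rcases le_total (6 * r) n with hrn | hrn
  · calc min (5 / 4 * δ) (1 / 12) * (2 * n ^ 2) ≤ 5 / 4 * δ * (2 * n ^ 2) := by
          gcongr; exact min_le_left _ _
      _ = 5 / 2 * (δ * n * n) := by ring
      _ ≤ 5 / 2 * (r * n) := by gcongr
      _ ≤ t + r * n := by nlinarith [mul_le_mul_of_nonneg_left hrn hr]
  · calc min (5 / 4 * δ) (1 / 12) * (2 * n ^ 2) ≤ 1 / 12 * (2 * n ^ 2) := by
          gcongr; exact min_le_right _ _
      _ ≤ t + r * n := by nlinarith [mul_le_mul_of_nonneg_right hrn hn]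

theorem IsRankApprox.tensorDouble {φ : Γ → V ≃ₗ[K] V} {E : Finset Γ} {ε : ℝ} {δ : Γ → ℝ}
    (h : IsRankApprox φ E ε δ) :
    IsRankApprox (fun g => tensorDoubleEquiv (φ g)) E (3 / 2 * ε)
      (fun g => min (5 / 4 * δ g) (1 / 12)) := by
  have key (A B : V →ₗ[K] V) (hAB : (linRank (A - B) : ℝ) ≤ ε * finrank K V) :
      (linRank (_root_.tensorDouble A - _root_.tensorDouble B) : ℝ) ≤
        3 / 2 * ε * finrank K ((V ⊗[K] V) × (V ⊗[K] V)) := by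
    have h1 : (linRank (_root_.tensorDouble A - _root_.tensorDouble B) : ℝ) ≤
      3 * (linRank (A - B) * finrank K V) := mod_cast linRank_tensorDouble_sub_le A B
    have h2 := mul_le_mul_of_nonneg_right hAB (Nat.cast_nonneg (α := ℝ) (finrank K V))
    rw [finrank_tensorDouble]
    push_cast
    linarith
  refine ⟨?_, fun g hg hg1 => ?_, fun g hg k hk => ?_⟩
  · have := key _ _ h.map_one
    rwa [tensorDouble_id] at this
  · exact le_linRank_tensorDouble_sub_id _ (h.le_rank g hg hg1)
  · have := key _ _ (h.map_mul g hg k hk)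
    rwa [tensorDouble_comp] at this

end Amplification

theorem HasRankApprox.amplify {E : Finset Γ} {ε : ℝ} {δ : Γ → ℝ}
    (h : HasRankApprox K E ε δ) :
    HasRankApprox K E (3 / 2 * ε) (fun g => min (5 / 4 * δ g) (1 / 12)) := by
  obtain ⟨V, i1, i2, i3, i4, φ, h⟩ := h
  have : Nontrivial (V ⊗[K] V) := by
    rw [← Module.finrank_pos_iff (R := K), Module.finrank_tensorProduct]
    exact Nat.mul_pos Module.finrank_pos Module.finrank_pos
  exact ⟨_, inferInstance, inferInstance, inferInstance, inferInstance, _, h.tensorDouble⟩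

theorem HasRankApprox.amplify_iterate {E : Finset Γ} {ε : ℝ} {δ : Γ → ℝ} (k : ℕ)
    (h : HasRankApprox K E ε δ) :
    HasRankApprox K E ((3 / 2) ^ k * ε) (fun g => min ((5 / 4) ^ k * δ g) (1 / 12)) := by
  induction k with
  | zero => exact h.mono (by simp) (by simp)
  | succ k ih =>
    refine ih.amplify.mono (by rw [pow_succ']; linarith) fun g _ _ => ?_
    refine le_min (?_) (min_le_right _ _)
    rcases min_cases ((5 / 4) ^ k * δ g) (1 / 12 : ℝ) with ⟨h1, h2⟩ | ⟨h1, h2⟩ <;> rw [h1]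
    · rw [← mul_assoc, ← pow_succ']; exact min_le_left _ _
    · exact (min_le_right _ _).trans (by norm_num)

/-- Positive lower bounds, chosen in advance of the required precision, can be replaced by a
uniform one. -/
theorem hasRankApprox_uniform {δ : Γ → ℝ} (hδ : ∀ g, g ≠ 1 → 0 < δ g) {E : Finset Γ}
    (h : ∀ ε : ℝ, 0 < ε → HasRankApprox K E ε δ) {ε : ℝ} (hε : 0 < ε) :
    HasRankApprox K E ε (fun _ => 1 / 12) := by
  -- This `k` does not depend on `ε`, so the initial precision `ε / (3/2) ^ k` can be prescribed
  -- afterwards.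
  have hk : ∃ k : ℕ, ∀ g ∈ E, g ≠ 1 → 1 / 12 ≤ (5 / 4 : ℝ) ^ k * δ g := by
    have : ∀ᶠ k : ℕ in Filter.atTop, ∀ g ∈ E, g ≠ 1 → 1 / 12 ≤ (5 / 4 : ℝ) ^ k * δ g := by
      rw [Filter.eventually_all_finset]
      intro g _
      rw [Filter.eventually_imp_distrib_left]
      intro hg
      exact ((tendsto_pow_atTop_atTop_of_one_lt (by norm_num : (1 : ℝ) < 5 / 4)).atTop_mul_const
        (hδ g hg)).eventually_ge_atTop _
    exact this.exists
  obtain ⟨k, hk⟩ := hk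
  refine ((h (ε / (3 / 2) ^ k) (by positivity)).amplify_iterate k).mono ?_ fun g hg hg1 => ?_
  · rw [mul_div_cancel₀]; positivity
  · exact le_min (hk g hg hg1) le_rfl

end Approximation

/-! ### Translation between matrices and automorphisms. -/

section Matrices

variable {K : Type v} [Field K] {Γ : Type u} [Group Γ]

variable (K) in
/-- Invertible matrices as automorphisms of `K ^ n`. -/
noncomputable def glEquiv (n : ℕ) :
    Matrix.GeneralLinearGroup (Fin n) K ≃* ((Fin n → K) ≃ₗ[K] (Fin n → K)) :=
  Matrix.GeneralLinearGroup.toLin.trans (LinearMap.GeneralLinearGroup.generalLinearEquiv K _)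

theorem coe_glEquiv {n : ℕ} (g : Matrix.GeneralLinearGroup (Fin n) K) :
    (glEquiv K n g : (Fin n → K) →ₗ[K] (Fin n → K)) =
      Matrix.toLin' (g : Matrix (Fin n) (Fin n) K) := by
  ext; rfl

theorem rankLength_eq {n : ℕ} (g : Matrix.GeneralLinearGroup (Fin n) K) :
    rankLength n g =
      (linRank ((glEquiv K n g : (Fin n → K) →ₗ[K] (Fin n → K)) - LinearMap.id) : ℝ) / n := by
  rw [linRank_sub_comm, coe_glEquiv, ← Matrix.toLin'_one, ← map_sub]
  rfl

/-- Composing with the automorphism of `k` on the right does not change the rank and turns the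
quotient into a difference. -/
theorem rankLength_mul_mul_inv {n : ℕ} (g h k : Matrix.GeneralLinearGroup (Fin n) K) :
    rankLength n (g * h * k⁻¹) =
      (linRank ((glEquiv K n g : (Fin n → K) →ₗ[K] (Fin n → K)) ∘ₗ
        (glEquiv K n h : (Fin n → K) →ₗ[K] (Fin n → K)) -
        (glEquiv K n k : (Fin n → K) →ₗ[K] (Fin n → K))) : ℝ) / n := by
  rw [rankLength_eq, ← linRank_comp_linearEquiv _ (glEquiv K n k), LinearMap.sub_comp,
    LinearMap.id_comp]
  congr 4
  refine LinearMap.ext fun x => ?_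
  rw [map_mul, map_mul, map_inv]
  change glEquiv K n g (glEquiv K n h ((glEquiv K n k).symm (glEquiv K n k x))) = _
  rw [LinearEquiv.symm_apply_apply]
  rfl

theorem IsKSofic.exists_hasRankApprox (h : IsKSofic K Γ) :
    ∃ δ : Γ → ℝ, (∀ g, g ≠ 1 → 0 < δ g) ∧
      ∀ ε : ℝ, 0 < ε → ∀ E : Finset Γ, HasRankApprox K E ε δ := by
  obtain ⟨δ, hδ, h⟩ := h
  refine ⟨δ, hδ, fun ε hε E => ?_⟩
  obtain ⟨⟨n, hn⟩, φ, h1, h2, h3⟩ := h ε hε E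
  have hn' : (0 : ℝ) < n := Nat.cast_pos.2 hn
  have : NeZero n := ⟨hn.ne'⟩
  refine ⟨Fin n → K, inferInstance, inferInstance, inferInstance, inferInstance,
    fun g => glEquiv K n (φ g), ?_, fun g hg hg1 => ?_, fun g hg k hk => ?_⟩
  · rw [Module.finrank_fin_fun, ← div_le_iff₀ hn', ← rankLength_eq]
    exact h1
  · rw [Module.finrank_fin_fun, ← le_div_iff₀ hn', ← rankLength_eq]
    exact h2 g hg hg1
  · rw [Module.finrank_fin_fun, ← div_le_iff₀ hn', ← rankLength_mul_mul_inv]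
    exact h3 g hg k hk

theorem IsRankApprox.exists_generalLinearGroup {V : Type*} [AddCommGroup V] [Module K V]
    [FiniteDimensional K V] [Nontrivial V] {φ : Γ → V ≃ₗ[K] V} {E : Finset Γ} {ε : ℝ} {δ : Γ → ℝ}
    (h : IsRankApprox φ E ε δ) :
    ∃ (n : {n : ℕ // 0 < n}) (ψ : Γ → Matrix.GeneralLinearGroup (Fin n.1) K),
      rankLength n.1 (ψ 1) ≤ ε ∧
      (∀ g ∈ E, g ≠ 1 → δ g ≤ rankLength n.1 (ψ g)) ∧
      (∀ g ∈ E, ∀ h ∈ E, rankLength n.1 (ψ g * ψ h * (ψ (g * h))⁻¹) ≤ ε) := by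
  have hn : 0 < finrank K V := Module.finrank_pos
  have hn' : (0 : ℝ) < finrank K V := Nat.cast_pos.2 hn
  let e : V ≃ₗ[K] (Fin (finrank K V) → K) := (Module.finBasis K V).equivFun
  have key (f : V →ₗ[K] V) : linRank (e.toLinearMap ∘ₗ f ∘ₗ e.symm.toLinearMap) = linRank f := by
    rw [linRank_linearEquiv_comp, linRank_comp_linearEquiv]
  let ψ : Γ → Matrix.GeneralLinearGroup (Fin (finrank K V)) K := fun g =>
    (glEquiv K _).symm (e.symm ≪≫ₗ φ g ≪≫ₗ e)
  have h1 (g : Γ) : rankLength _ (ψ g) =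
      (linRank ((φ g : V →ₗ[K] V) - LinearMap.id) : ℝ) / finrank K V := by
    rw [rankLength_eq, MulEquiv.apply_symm_apply, ← key]
    congr 3
    refine LinearMap.ext fun x => ?_
    simp
  have h2 (g h k : Γ) : rankLength _ (ψ g * ψ h * (ψ k)⁻¹) =
      (linRank ((φ g : V →ₗ[K] V) ∘ₗ (φ h : V →ₗ[K] V) - (φ k : V →ₗ[K] V)) : ℝ) /
        finrank K V := by
    rw [rankLength_mul_mul_inv, MulEquiv.apply_symm_apply, MulEquiv.apply_symm_apply,
      MulEquiv.apply_symm_apply, ← key]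
    congr 3
    refine LinearMap.ext fun x => ?_
    simp
  refine ⟨⟨_, hn⟩, ψ, ?_, fun g hg hg1 => ?_, fun g hg k hk => ?_⟩
  · rw [h1, div_le_iff₀ hn']; exact h.map_one
  · rw [h1, le_div_iff₀ hn']; exact h.le_rank g hg hg1
  · rw [h2, div_le_iff₀ hn']; exact h.map_mul g hg k hk

end Matrices

/-! ### Ranks of block monomial automorphisms. -/

section Monomial

variable {K : Type*} [Field K] {V : Type*} [AddCommGroup V] [Module K V] {ι : Type*}

/-- The automorphism of `V ^ ι` that maps the `q`-th copy of `V` to the `π q`-th one by `a q`. -/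
def monomialEquiv (π : Equiv.Perm ι) (a : ι → V ≃ₗ[K] V) : (ι → V) ≃ₗ[K] (ι → V) :=
  (LinearEquiv.piCongrRight a).trans (LinearEquiv.funCongrLeft K V π.symm)

theorem monomialEquiv_apply (π : Equiv.Perm ι) (a : ι → V ≃ₗ[K] V) (v : ι → V) (p : ι) :
    monomialEquiv π a v p = a (π.symm p) (v (π.symm p)) := rfl

theorem monomialEquiv_comp (π ρ : Equiv.Perm ι) (a b : ι → V ≃ₗ[K] V) :
    (monomialEquiv π a : (ι → V) →ₗ[K] (ι → V)) ∘ₗ (monomialEquiv ρ b : (ι → V) →ₗ[K] (ι → V)) =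
      monomialEquiv (ρ.trans π) (fun q => (b q).trans (a (ρ q))) := by
  refine LinearMap.ext fun v => funext fun p => ?_
  simp [monomialEquiv_apply]

theorem monomialEquiv_refl :
    (monomialEquiv (Equiv.refl ι) (fun _ => LinearEquiv.refl K V) : (ι → V) →ₗ[K] (ι → V)) =
      LinearMap.id := by
  refine LinearMap.ext fun v => funext fun p => ?_
  simp [monomialEquiv_apply]

theorem monomialEquiv_comp_single [DecidableEq ι] (π : Equiv.Perm ι) (a : ι → V ≃ₗ[K] V) (q : ι) :
    (monomialEquiv π a : (ι → V) →ₗ[K] (ι → V)) ∘ₗ LinearMap.single K (fun _ => V) q =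
      LinearMap.single K (fun _ => V) (π q) ∘ₗ (a q : V →ₗ[K] V) := by
  refine LinearMap.ext fun v => funext fun p => ?_
  obtain ⟨p, rfl⟩ := π.surjective p
  by_cases h : p = q
  · subst h; simp [monomialEquiv_apply]
  · simp [monomialEquiv_apply, h]

variable [Fintype ι] [FiniteDimensional K V]

/-- Decompose the difference into block columns: one outside `B` has a single nonzero block, of rank
at most `c`; one in `B` has rank at most `finrank K V`. -/
theorem linRank_monomialEquiv_sub_le (π ρ : Equiv.Perm ι) (a b : ι → V ≃ₗ[K] V) (B : Finset ι)
    (hB : ∀ q ∉ B, π q = ρ q) {c : ℝ} (hc : 0 ≤ c)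
    (hab : ∀ q ∉ B, (linRank ((a q : V →ₗ[K] V) - (b q : V →ₗ[K] V)) : ℝ) ≤ c) :
    (linRank ((monomialEquiv π a : (ι → V) →ₗ[K] (ι → V)) -
      (monomialEquiv ρ b : (ι → V) →ₗ[K] (ι → V))) : ℝ) ≤
      Fintype.card ι * c + B.card * finrank K V := by
  classical
  set D := (monomialEquiv π a : (ι → V) →ₗ[K] (ι → V)) -
      (monomialEquiv ρ b : (ι → V) →ₗ[K] (ι → V)) with hD
  have hsum : D = ∑ q, (D ∘ₗ LinearMap.single K (fun _ => V) q) ∘ₗ LinearMap.proj q := by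
    refine LinearMap.ext fun v => ?_
    conv_lhs => rw [← LinearMap.sum_single_apply (fun _ => V) v, map_sum]
    simp
  have hq (q : ι) : (linRank ((D ∘ₗ LinearMap.single K (fun _ => V) q) ∘ₗ
      (LinearMap.proj q : (ι → V) →ₗ[K] V)) : ℝ) ≤ c + if q ∈ B then (finrank K V : ℝ) else 0 := by
    refine (Nat.cast_le.2 (linRank_comp_le_left _ _)).trans ?_
    split_ifs with h
    · refine (Nat.cast_le.2 (linRank_le_domain _)).trans (by linarith)
    · rw [hD, LinearMap.sub_comp, monomialEquiv_comp_single, monomialEquiv_comp_single, hB q h,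
        ← LinearMap.comp_sub, add_zero]
      exact (Nat.cast_le.2 (linRank_comp_le_right _ _)).trans (hab q h)
  calc (linRank D : ℝ) ≤ ∑ q, (linRank ((D ∘ₗ LinearMap.single K (fun _ => V) q) ∘ₗ
      (LinearMap.proj q : (ι → V) →ₗ[K] V)) : ℝ) := by
        conv_lhs => rw [hsum]
        exact_mod_cast linRank_sum_le _ _
    _ ≤ ∑ q, (c + if q ∈ B then (finrank K V : ℝ) else 0) := Finset.sum_le_sum fun q _ => hq q
    _ = Fintype.card ι * c + B.card * finrank K V := by
        simp [Finset.sum_add_distrib, Finset.sum_ite_mem]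

theorem sum_linRank_le_linRank_monomialEquiv_refl (a : ι → V ≃ₗ[K] V) :
    ∑ q, linRank ((a q : V →ₗ[K] V) - LinearMap.id) ≤
      linRank ((monomialEquiv (Equiv.refl ι) a : (ι → V) →ₗ[K] (ι → V)) - LinearMap.id) := by
  let R (q : ι) : V →ₗ[K] V := (a q : V →ₗ[K] V) - LinearMap.id
  let j : (∀ q, LinearMap.range (R q)) →ₗ[K] (ι → V) :=
    LinearMap.pi fun q => (LinearMap.range (R q)).subtype ∘ₗ LinearMap.proj q
  have hj : Function.Injective j := fun v w h => funext fun q => Subtype.ext (congrFun h q)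
  have h1 : finrank K (LinearMap.range j) = ∑ q, linRank (R q) := by
    rw [LinearMap.finrank_range_of_inj hj, Module.finrank_pi_fintype]
    rfl
  change ∑ q, linRank (R q) ≤ _
  rw [← h1]
  refine Submodule.finrank_mono ?_
  rintro _ ⟨v, rfl⟩
  choose w hw using fun q => (v q).2
  exact ⟨w, funext fun q => hw q⟩

/-- For a maximal `T`, a point of `S` that cannot be added lies in `T`, `π T` or `π⁻¹ T`. -/
theorem exists_subset_disjoint_image {α : Type*} [DecidableEq α] (π : Equiv.Perm α)
    (S : Finset α) (hS : ∀ q ∈ S, π q ≠ q) :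
    ∃ T ⊆ S, (∀ q ∈ T, π q ∉ T) ∧ S.card ≤ 3 * T.card := by
  obtain ⟨T, hT⟩ := (S.powerset.filter fun T => ∀ q ∈ T, π q ∉ T).exists_maximal ⟨∅, by simp⟩
  have hT1 := hT.prop
  rw [Finset.mem_filter, Finset.mem_powerset] at hT1
  refine ⟨T, hT1.1, hT1.2, ?_⟩
  have hsub : S ⊆ T ∪ (T.image π ∪ T.image π.symm) := by
    intro x hx
    by_contra hx'
    simp only [Finset.mem_union, Finset.mem_image, not_or, not_exists, not_and] at hx'
    obtain ⟨hxT, hx1, hx2⟩ := hx'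
    have hmem : insert x T ∈ S.powerset.filter fun T => ∀ q ∈ T, π q ∉ T := by
      rw [Finset.mem_filter, Finset.mem_powerset]
      refine ⟨Finset.insert_subset hx hT1.1, fun q hq => ?_⟩
      rw [Finset.mem_insert] at hq ⊢
      rintro (h | h)
      · rcases hq with rfl | hq
        · exact hS _ hx h
        · exact hx1 q hq h
      · rcases hq with rfl | hq
        · exact hx2 _ h (by simp)
        · exact hT1.2 q hq h
    exact hxT (hT.le_of_ge hmem (Finset.subset_insert x T) (Finset.mem_insert_self x T))
  calc S.card ≤ (T ∪ (T.image π ∪ T.image π.symm)).card := Finset.card_le_card hsub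
    _ ≤ T.card + ((T.image π).card + (T.image π.symm).card) :=
        (Finset.card_union_le _ _).trans (Nat.add_le_add_left (Finset.card_union_le _ _) _)
    _ ≤ T.card + (T.card + T.card) := Nat.add_le_add_left
        (Nat.add_le_add Finset.card_image_le Finset.card_image_le) _
    _ = 3 * T.card := by ring

/-- With `T` and `π T` disjoint, the automorphism minus `1` is injective on vectors supported on
`T`: their `π q` coordinate becomes `a q (v q)`. -/
theorem card_mul_finrank_le_linRank_monomialEquiv (π : Equiv.Perm ι) (a : ι → V ≃ₗ[K] V)
    (S : Finset ι) (hS : ∀ q ∈ S, π q ≠ q) :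
    S.card * finrank K V ≤
      3 * linRank ((monomialEquiv π a : (ι → V) →ₗ[K] (ι → V)) - LinearMap.id) := by
  classical
  obtain ⟨T, -, hT, hcard⟩ := exists_subset_disjoint_image π S hS
  let j : (T → V) →ₗ[K] (ι → V) :=
    LinearMap.pi fun q => if h : q ∈ T then LinearMap.proj ⟨q, h⟩ else 0
  have hj1 (v : T → V) (q : T) : j v q = v q := by simp [j]
  have hj0 (v : T → V) (q : ι) (hq : q ∉ T) : j v q = 0 := by simp [j, hq]
  have hinj : Function.Injective
      (((monomialEquiv π a : (ι → V) →ₗ[K] (ι → V)) - LinearMap.id) ∘ₗ j) := by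
    rw [← LinearMap.ker_eq_bot, LinearMap.ker_eq_bot']
    intro v hv
    funext q
    have h := congrFun hv (π q)
    simpa [monomialEquiv_apply, hj1, hj0 v _ (hT q q.2)] using h
  have h := linRank_comp_le_left ((monomialEquiv π a : (ι → V) →ₗ[K] (ι → V)) - LinearMap.id) j
  rw [linRank_eq_domain_of_injective _ hinj, Module.finrank_pi_fintype] at h
  simp only [Finset.sum_const, Finset.card_univ, Fintype.card_coe, smul_eq_mul] at h
  calc S.card * finrank K V ≤ 3 * T.card * finrank K V := by gcongr
    _ = 3 * (T.card * finrank K V) := by ring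
    _ ≤ _ := by gcongr

end Monomial

/-! ### Følner sets, the section cocycle and induction. -/

section Extension

theorem card_filter_mul_notMem_le {Q : Type*} [Group Q] [DecidableEq Q] (F : Finset Q) (s : Q) :
    (Finset.univ.filter fun q : F => s * (q : Q) ∉ F).card ≤
      (symmDiff (F.image fun x => s * x) F).card := by
  refine Finset.card_le_card_of_injOn (fun q => s * (q : Q)) (fun q hq => ?_) fun p _ q _ h => ?_
  · rw [Finset.mem_coe, Finset.mem_filter] at hq
    rw [Finset.mem_coe, Finset.mem_symmDiff]
    exact Or.inl ⟨Finset.mem_image_of_mem _ q.2, hq.2⟩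
  · exact Subtype.ext (mul_left_cancel h)

/-- An injective partial self-map of a finite set always extends to a permutation. -/
theorem exists_perm_extending_mul {Q : Type*} [Group Q] (F : Finset Q) (s : Q) :
    ∃ π : Equiv.Perm F, ∀ q : F, s * (q : Q) ∈ F → (π q : Q) = s * (q : Q) := by
  classical
  obtain ⟨π, hπ⟩ := Finset.exists_equiv_extend_of_card_eq (α := F) (t := F) (Fintype.card_coe F)
    (s := Finset.univ.filter fun q : F => s * (q : Q) ∈ F) (f := fun q => s * (q : Q))
    (by
      intro x hx
      obtain ⟨q, hq, rfl⟩ := Finset.mem_image.1 hx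
      exact (Finset.mem_filter.1 hq).2)
    (fun p _ q _ h => Subtype.ext (mul_left_cancel h))
  exact ⟨π, fun q hq => hπ q (Finset.mem_filter.2 ⟨Finset.mem_univ q, hq⟩)⟩

variable {Γ : Type u} [Group Γ] {N : Subgroup Γ} [N.Normal]

variable (N) in
/-- The cocycle `Γ × Γ ⧸ N → N` of the set-theoretic section `Quotient.out`. -/
noncomputable def sectionCocycle (g : Γ) (q : Γ ⧸ N) : N :=
  ⟨((g : Γ ⧸ N) * q).out⁻¹ * g * q.out, by
    rw [← QuotientGroup.eq_one_iff]
    simp⟩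

theorem coe_sectionCocycle (g : Γ) (q : Γ ⧸ N) :
    (sectionCocycle N g q : Γ) = ((g : Γ ⧸ N) * q).out⁻¹ * g * q.out := rfl

theorem sectionCocycle_one (q : Γ ⧸ N) : sectionCocycle N 1 q = 1 := by
  apply Subtype.ext
  simp [coe_sectionCocycle]

theorem sectionCocycle_mul (g h : Γ) (q : Γ ⧸ N) :
    sectionCocycle N g ((h : Γ ⧸ N) * q) * sectionCocycle N h q = sectionCocycle N (g * h) q := by
  apply Subtype.ext
  simp [coe_sectionCocycle, mul_assoc]

/-- For `g` in `N` the cocycle value is a conjugate of `g`. -/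
theorem sectionCocycle_ne_one {g : Γ} (hg : (g : Γ ⧸ N) = 1) (hg1 : g ≠ 1) (q : Γ ⧸ N) :
    sectionCocycle N g q ≠ 1 := by
  intro h
  have h' := congrArg Subtype.val h
  rw [coe_sectionCocycle, hg, one_mul] at h'
  exact hg1 (conj_eq_one_iff (a := q.out⁻¹).1 (by simpa using h'))

variable {K : Type v} [Field K] {V : Type*} [AddCommGroup V] [Module K V] [FiniteDimensional K V]

/-- The approximation of `Γ` induced from one of `N` along a Følner set of `Γ ⧸ N`. -/
theorem IsRankApprox.exists_induced [DecidableEq (Γ ⧸ N)] {ψ : N → V ≃ₗ[K] V} {E' : Finset N} {η : ℝ} {δ : ℝ}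
    (hψ : IsRankApprox ψ E' η (fun _ => δ)) (hη : 0 ≤ η) (hη' : η ≤ 1 / 2) (hδ : δ ≤ 1 / 6)
    (F : Finset (Γ ⧸ N)) (E : Finset Γ)
    (hE' : ∀ g ∈ E, ∀ q ∈ F, sectionCocycle N g q ∈ E')
    (hF : ∀ g ∈ E, ((Finset.univ.filter fun q : F => (g : Γ ⧸ N) * q ∉ F).card : ℝ) ≤ η * F.card)
    (hF2 : ∀ g ∈ E, ∀ h ∈ E,
      ((Finset.univ.filter fun q : F => ((g * h : Γ) : Γ ⧸ N) * q ∉ F).card : ℝ) ≤ η * F.card) :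
    ∃ φ : Γ → (F → V) ≃ₗ[K] (F → V), IsRankApprox φ E (3 * η) (fun _ => δ) := by
  classical
  choose π hπ using fun g : Γ => exists_perm_extending_mul F (g : Γ ⧸ N)
  have hπ1 (g : Γ) (hg : (g : Γ ⧸ N) = 1) : π g = Equiv.refl F := by
    ext q
    rw [hπ g q (by rw [hg, one_mul]; exact q.2), hg, one_mul]
    rfl
  have hdim : (finrank K (F → V) : ℝ) = F.card * finrank K V := by
    rw [Module.finrank_pi_fintype]
    simp
  refine ⟨fun g => monomialEquiv (π g) fun q => ψ (sectionCocycle N g q), ?_, ?_, ?_⟩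
  · have h := linRank_monomialEquiv_sub_le (π 1) (Equiv.refl F)
      (fun q => ψ (sectionCocycle N 1 q)) (fun _ => LinearEquiv.refl K V) ∅
      (fun q _ => by rw [hπ1 1 rfl]) (c := η * finrank K V) (by positivity)
      (fun q _ => by rw [sectionCocycle_one]; exact hψ.map_one)
    rw [monomialEquiv_refl] at h
    rw [hdim]
    refine h.trans ?_
    rw [Fintype.card_coe, Finset.card_empty, Nat.cast_zero, zero_mul, add_zero]
    have : 0 ≤ η * (F.card * finrank K V) := by positivity
    linarith
  · intro g hg hg1
    rw [hdim]
    by_cases hgN : (g : Γ ⧸ N) = 1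
    · rw [hπ1 g hgN]
      calc δ * (F.card * finrank K V) = ∑ q : F, δ * finrank K V := by
            rw [Finset.sum_const, Finset.card_univ, Fintype.card_coe, nsmul_eq_mul]; ring
        _ ≤ ∑ q : F, (linRank ((ψ (sectionCocycle N g q) : V →ₗ[K] V) - LinearMap.id) : ℝ) :=
            Finset.sum_le_sum fun q _ => hψ.le_rank _ (hE' g hg q q.2)
              (sectionCocycle_ne_one hgN hg1 q)
        _ ≤ _ := by
            exact_mod_cast sum_linRank_le_linRank_monomialEquiv_refl
              (fun q : F => ψ (sectionCocycle N g q))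
    -- Outside `N`, `g` has no fixed point on `Γ ⧸ N`. At least half of `F` stays in `F`, and a
    -- third of that contributes full blocks, whence the constant `1/6`.
    · have h := card_mul_finrank_le_linRank_monomialEquiv (π g)
        (fun q => ψ (sectionCocycle N g q)) (Finset.univ.filter fun q : F => (g : Γ ⧸ N) * q ∈ F)
        (fun q hq hfix => by
          have h1 := hπ g q (Finset.mem_filter.1 hq).2
          rw [hfix] at h1
          exact hgN (mul_eq_right.1 h1.symm))
      have hcard := Finset.card_filter_add_card_filter_not (s := (Finset.univ : Finset F))
        (fun q : F => (g : Γ ⧸ N) * q ∈ F)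
      rw [Finset.card_univ, Fintype.card_coe] at hcard
      have hc := hF g hg
      have hcard' : (F.card : ℝ) ≤
          2 * (Finset.univ.filter fun q : F => (g : Γ ⧸ N) * q ∈ F).card := by
        rw [← @Nat.cast_inj ℝ, Nat.cast_add] at hcard
        have := mul_le_mul_of_nonneg_right hη' (Nat.cast_nonneg (α := ℝ) F.card)
        linarith
      rw [← @Nat.cast_le ℝ, Nat.cast_mul, Nat.cast_mul] at h
      have h3 := mul_le_mul_of_nonneg_right hcard' (Nat.cast_nonneg (α := ℝ) (finrank K V))
      have h4 := mul_le_mul_of_nonneg_right hδ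
        (by positivity : (0 : ℝ) ≤ F.card * finrank K V)
      push_cast at h
      linarith
  · intro g hg k hk
    rw [monomialEquiv_comp, hdim]
    -- Off `B` both `kq` and `g(kq) = (gk)q` lie in `F`, so the two permutations agree. The blocks
    -- contribute `η` and `B` contributes `2η`, giving `3η`.
    set B : Finset F := (Finset.univ.filter fun q : F => (k : Γ ⧸ N) * q ∉ F) ∪
      (Finset.univ.filter fun q : F => ((g * k : Γ) : Γ ⧸ N) * q ∉ F) with hB
    have hBcard : (B.card : ℝ) ≤ 2 * η * F.card := by
      have h1 : (B.card : ℝ) ≤ _ := Nat.cast_le.2 (Finset.card_union_le _ _)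
      rw [Nat.cast_add] at h1
      linarith [hF k hk, hF2 g hg k hk]
    have hgood (q : F) (hq : q ∉ B) : (k : Γ ⧸ N) * q ∈ F ∧ ((g * k : Γ) : Γ ⧸ N) * q ∈ F := by
      rw [hB, Finset.mem_union, not_or, Finset.mem_filter, Finset.mem_filter] at hq
      simpa only [Finset.mem_univ, true_and, not_not] using hq
    have h := linRank_monomialEquiv_sub_le ((π k).trans (π g)) (π (g * k))
      (fun q => (ψ (sectionCocycle N k q)).trans (ψ (sectionCocycle N g (π k q))))
      (fun q => ψ (sectionCocycle N (g * k) q)) B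
      (fun q hq => by
        obtain ⟨h1, h2⟩ := hgood q hq
        apply Subtype.ext
        have h3 : (g : Γ ⧸ N) * (π k q : Γ ⧸ N) = ((g * k : Γ) : Γ ⧸ N) * q := by
          rw [hπ k q h1, QuotientGroup.mk_mul, mul_assoc]
        rw [hπ (g * k) q h2, Equiv.trans_apply, hπ g (π k q) (by rw [h3]; exact h2), h3])
      (c := η * finrank K V) (by positivity)
      (fun q hq => by
        obtain ⟨h1, h2⟩ := hgood q hq
        rw [hπ k q h1, ← sectionCocycle_mul]
        exact hψ.map_mul _ (hE' g hg _ h1) _ (hE' k hk q q.2))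
    refine h.trans ?_
    rw [Fintype.card_coe]
    have := mul_le_mul_of_nonneg_right hBcard (Nat.cast_nonneg (α := ℝ) (finrank K V))
    linarith

end Extension

/-! ### Permanence under extensions with amenable quotient. -/

theorem mainTheorem8 {K : Type v} [Field K] {Γ : Type u} [Group Γ] (N : Subgroup Γ) [N.Normal]
    (hN : IsKSofic K N) (hQ : IsAmenableGroup (Γ ⧸ N)) : IsKSofic K Γ := by
  classical
  obtain ⟨δ, hδ, hN⟩ := hN.exists_hasRankApprox
  refine ⟨fun _ => 1 / 12, fun _ _ => by norm_num, fun ε hε E => ?_⟩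
  set η : ℝ := min (ε / 3) (1 / 2) with hη
  have hη0 : 0 < η := lt_min (by positivity) (by norm_num)
  obtain ⟨F, hFne, hF⟩ := hQ ((E ∪ (E ×ˢ E).image fun p => p.1 * p.2).image
    (fun g : Γ => (g : Γ ⧸ N))) η hη0
  have hF' (g : Γ) (hg : g ∈ E ∪ (E ×ˢ E).image fun p => p.1 * p.2) :
      ((Finset.univ.filter fun q : F => (g : Γ ⧸ N) * q ∉ F).card : ℝ) ≤ η * F.card := by
    refine (Nat.cast_le.2 ?_).trans (hF g (Finset.mem_image_of_mem _ hg))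
    convert card_filter_mul_notMem_le F (g : Γ ⧸ N)
  -- The finite subset of `N` depends on `F`; the uniform bound `1/12` is what makes this order of
  -- choices harmless.
  obtain ⟨V, _, _, _, _, ψ, hψ⟩ := hasRankApprox_uniform hδ
    (E := (E ×ˢ F).image fun p => sectionCocycle N p.1 p.2) (fun ε hε => hN ε hε _) hη0
  obtain ⟨φ, hφ⟩ := hψ.exists_induced hη0.le (min_le_right _ _) (by norm_num) F E
    (fun g hg q hq => Finset.mem_image.2 ⟨(g, q), Finset.mem_product.2 ⟨hg, hq⟩, rfl⟩)
    (fun g hg => by convert hF' g (Finset.mem_union_left _ hg))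
    (fun g hg h hh => by
      convert hF' (g * h) (Finset.mem_union_right _
        (Finset.mem_image.2 ⟨(g, h), Finset.mem_product.2 ⟨hg, hh⟩, rfl⟩)))
  have : Nonempty F := hFne.to_subtype
  obtain ⟨n, χ, h1, h2, h3⟩ := hφ.exists_generalLinearGroup
  have hε' : 3 * η ≤ ε := by linarith [min_le_left (ε / 3) (1 / 2)]
  exact ⟨n, χ, h1.trans hε', h2, fun g hg h hh => (h3 g hg h hh).trans hε'⟩
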